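/- Let $q\in L^1_{loc}(\mathbb R)$ be real valued and even, and suppose that the differential expression $\tau_q y=-y''-qy$ on $\mathbb R$ is in the limit circle case at $+\infty$ and at $-\infty$, i.e. for every $\lambda\in\mathbb C$ all solutions of $\tau_q y=\lambda y$ are square integrable near $+\infty$ and near $-\infty$. Let $$\mathcal D_{\max}=\{y\in L^2(\mathbb R): y,y'\in AC_{loc}(\mathbb R),\ \tau_q y\in L^2(\mathbb R)\},$$ let $A_{\max}y=\tau_q y$ on $\mathcal D_{\max}$, let $A$ be the minimal operator, i.e. the closure of the restriction of $A_{\max}$ to the functions in $\mathcal D_{\max}$ with compact support, and recall that $A^*=A_{\max}$. A bi-extension of $A$ is a closed operator $\widetilde A$ with $A\subset\widetilde A\subset A^*$. Let $(\mathcal Pf)(x)=f(-x)$ and let $\widetilde A^+=\mathcal P\widetilde A^*\mathcal P$ be the adjoint of $\widetilde A$ in the Krein space $(L^2(\mathbb R),[\cdot,\cdot])$, $[f,g]=\int_{\mathbb R} f(x)\overline{g(-x)}\,dx$. For $f,g\in\mathcal D_{\max}$ put $[f,g]_x=\overline{f(x)}g'(x)-\overline{f'(x)}g(x)$ and $[f,g]_{\pm\infty}=\lim_{x\to\pm\infty}[f,g]_x$.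 Let $w_1,w_2\in\mathcal D_{\max}$ be real valued solutions of $\tau_q y=0$, $w_1$ odd and $w_2$ even, with $[w_1,w_2]_{-\infty}=[w_1,w_2]_{\infty}=1$, and put, for $f\in\mathcal D_{\max}$ and $j=1,2$, $$\alpha_j(f)=[w_j,f]_{-\infty},\qquad \beta_j(f)=[w_j,f]_{\infty}.$$ Let $\alpha,\beta,\gamma,\delta\in\mathbb C$ and let $\widetilde A$ be a bi-extension of $A$. (i) Suppose that for some $a_1,b_1\in\mathbb C$ with $|a_1|+|b_1|\neq0$ $$\operatorname{dom}\widetilde A=\Big\{f\in\mathcal D_{\max}: a_1\alpha_1(f)+b_1\alpha_2(f)=0,\ \begin{bmatrix}\alpha&\beta\\ \gamma&\delta\end{bmatrix}\begin{pmatrix}\alpha_1(f)\\ \alpha_2(f)\end{pmatrix}=\begin{pmatrix}\beta_1(f)\\ \beta_2(f)\end{pmatrix}\Big\}\qquad\text{(type I)}.$$ Put $$a=\overline{a_1},\quad b=\overline{b_1},\quad \begin{pmatrix}c\\ d\end{pmatrix}=-\begin{bmatrix}\overline\delta&-\overline\gamma\\ -\overline\beta&\overline\alpha\end{bmatrix}\begin{pmatrix}\overline{a_1}\\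 \overline{b_1}\end{pmatrix}.$$ Then $$\operatorname{dom}\widetilde A^*=\{g\in\mathcal D_{\max}: a\,\alpha_1(g)+b\,\alpha_2(g)+c\,\beta_1(g)+d\,\beta_2(g)=0\},$$ $$\operatorname{dom}\widetilde A^+=\mathcal P\operatorname{dom}\widetilde A^*=\{h\in\mathcal D_{\max}: a\,\beta_1(h)-b\,\beta_2(h)+c\,\alpha_1(h)-d\,\alpha_2(h)=0\}.$$ (ii) Suppose that for some $c_1,d_1\in\mathbb C$ with $|c_1|+|d_1|\neq0$ $$\operatorname{dom}\widetilde A=\Big\{f\in\mathcal D_{\max}: c_1\beta_1(f)+d_1\beta_2(f)=0,\ \begin{bmatrix}\alpha&\beta\\ \gamma&\delta\end{bmatrix}\begin{pmatrix}\beta_1(f)\\ \beta_2(f)\end{pmatrix}=\begin{pmatrix}\alpha_1(f)\\ \alpha_2(f)\end{pmatrix}\Big\}\qquad\text{(type II)}.$$ Put $$c=\overline{c_1},\quad d=\overline{d_1},\quad \begin{pmatrix}a\\ b\end{pmatrix}=-\begin{bmatrix}\overline\delta&-\overline\gamma\\ -\overline\beta&\overline\alpha\end{bmatrix}\begin{pmatrix}\overline{c_1}\\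 \overline{d_1}\end{pmatrix}.$$ Then the same two formulas for $\operatorname{dom}\widetilde A^*$ and $\operatorname{dom}\widetilde A^+=\mathcal P\operatorname{dom}\widetilde A^*$ hold with these $a,b,c,d$. -/

import Mathlib

open MeasureTheory Filter Topology Matrix
open scoped ComplexConjugate LinearPMap

noncomputable section

namespace PTSymm

/-- The complex Hilbert space `L²(ℝ)`. -/
abbrev L2R : Type := Lp ℂ 2 (volume : Measure ℝ)

/-- `AC_loc(ℝ)`: absolutely continuous on every compact interval. -/
def ACLoc (y : ℝ → ℂ) : Prop := ∀ a b : ℝ, AbsolutelyContinuousOnInterval y a b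

/-- `y, y' ∈ AC_loc(ℝ)`, where `y'` is the everywhere defined derivative of `y`. -/
structure IsACTwo (y : ℝ → ℂ) : Prop where
  diff : Differentiable ℝ y
  ac : ACLoc y
  ac_deriv : ACLoc (deriv y)

/-- The differential expression `τ_q y = - y'' - q y`. For `y, y' ∈ AC_loc(ℝ)` the second
derivative exists almost everywhere. -/
def tau (q : ℝ → ℝ) (y : ℝ → ℂ) (x : ℝ) : ℂ := -deriv (deriv y) x - (q x : ℂ) * y x

/-- `y` solves `τ_q y - lam y = 0` on `ℝ` (in the Carathéodory sense). -/
def IsSolution (q : ℝ → ℝ) (lam : ℂ) (y : ℝ → ℂ) : Prop :=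
  IsACTwo y ∧ ∀ᵐ x, tau q y x - lam * y x = 0

/-- Limit circle case at `+∞`. -/
def LimitCircleAtTop (q : ℝ → ℝ) : Prop :=
  ∀ (lam : ℂ) (y : ℝ → ℂ), IsSolution q lam y →
    ∃ a : ℝ, MemLp y 2 (volume.restrict (Set.Ioi a))

/-- Limit circle case at `-∞`. -/
def LimitCircleAtBot (q : ℝ → ℝ) : Prop :=
  ∀ (lam : ℂ) (y : ℝ → ℂ), IsSolution q lam y →
    ∃ a : ℝ, MemLp y 2 (volume.restrict (Set.Iio a))

/-- Membership in the maximal domain of `τ_q`. -/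
structure InMaxDomain (q : ℝ → ℝ) (y : ℝ → ℂ) : Prop where
  ac : IsACTwo y
  memLp : MemLp y 2 volume
  memLp_tau : MemLp (tau q y) 2 volume

theorem ACLoc.ae_differentiableAt {y : ℝ → ℂ} (h : ACLoc y) :
    ∀ᵐ x, DifferentiableAt ℝ y x := by
  have hn : ∀ n : ℕ, ∀ᵐ x : ℝ, x ∈ Set.uIcc (-(n : ℝ)) n → DifferentiableAt ℝ y x := fun n =>
    (h _ _).boundedVariationOn.ae_differentiableAt_of_mem_uIcc
  filter_upwards [ae_all_iff.2 hn] with x hx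
  obtain ⟨n, hxn⟩ := exists_nat_ge |x|
  refine hx n ?_
  rw [Set.uIcc_of_le (by linarith [abs_nonneg x])]
  exact abs_le.1 hxn

theorem IsACTwo.add {y z : ℝ → ℂ} (hy : IsACTwo y) (hz : IsACTwo z) : IsACTwo (y + z) where
  diff := hy.diff.add hz.diff
  ac a b := (hy.ac a b).add (hz.ac a b)
  ac_deriv a b := by
    have : deriv (y + z) = deriv y + deriv z := by
      ext x; exact deriv_add (hy.diff x) (hz.diff x)
    rw [this]
    exact (hy.ac_deriv a b).add (hz.ac_deriv a b)

theorem IsACTwo.smul {y : ℝ → ℂ} (c : ℂ) (hy : IsACTwo y) : IsACTwo (c • y) where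
  diff := hy.diff.const_smul c
  ac a b := (hy.ac a b).const_smul c
  ac_deriv a b := by
    have : deriv (c • y) = fun x => c • deriv y x := by
      ext x; exact deriv_const_smul c (hy.diff x)
    rw [this]
    exact (hy.ac_deriv a b).const_smul c

theorem IsACTwo.zero : IsACTwo (0 : ℝ → ℂ) where
  diff := differentiable_const 0
  ac a b := by simpa using! (contDiff_const (c := (0 : ℂ))).contDiffOn.absolutelyContinuousOnInterval
  ac_deriv a b := by
    have : deriv (0 : ℝ → ℂ) = fun _ => 0 := by ext x; simp
    rw [this]
    exact (contDiff_const (c := (0 : ℂ))).contDiffOn.absolutelyContinuousOnInterval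

theorem tau_add_ae (q : ℝ → ℝ) {y z : ℝ → ℂ} (hy : IsACTwo y) (hz : IsACTwo z) :
    tau q (y + z) =ᵐ[volume] tau q y + tau q z := by
  have hd : deriv (y + z) = deriv y + deriv z := by
    ext x; exact deriv_add (hy.diff x) (hz.diff x)
  filter_upwards [hy.ac_deriv.ae_differentiableAt, hz.ac_deriv.ae_differentiableAt] with x h1 h2
  simp only [tau, hd, Pi.add_apply]
  rw [deriv_add h1 h2]
  ring

theorem tau_smul (q : ℝ → ℝ) (c : ℂ) {y : ℝ → ℂ} (hy : IsACTwo y) :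
    tau q (c • y) = c • tau q y := by
  have hd : deriv (c • y) = c • deriv y := by
    ext x; exact deriv_const_smul c (hy.diff x)
  ext x
  simp only [tau, hd, Pi.smul_apply, smul_eq_mul]
  rw [show (c • deriv y) = fun t => c * deriv y t from rfl, deriv_const_mul_field]
  ring

theorem tau_zero (q : ℝ → ℝ) : tau q 0 = 0 := by
  have hd : deriv (0 : ℝ → ℂ) = 0 := by ext x; simp
  ext x
  simp [tau, hd]

/-- The maximal domain `D_max`, as a space of functions. -/
def maxDomain (q : ℝ → ℝ) : Submodule ℂ (ℝ → ℂ) where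
  carrier := {y | InMaxDomain q y}
  zero_mem' := ⟨IsACTwo.zero, MemLp.zero, by rw [tau_zero]; exact MemLp.zero⟩
  add_mem' hy hz := ⟨hy.ac.add hz.ac, hy.memLp.add hz.memLp,
    (hy.memLp_tau.add hz.memLp_tau).ae_eq (tau_add_ae q hy.ac hz.ac).symm⟩
  smul_mem' c _ hy := ⟨hy.ac.smul c, hy.memLp.const_smul c, by
    rw [tau_smul q c hy.ac]; exact hy.memLp_tau.const_smul c⟩

/-- A function of the maximal domain as an element of `L²(ℝ)`. -/
def toL2 (q : ℝ → ℝ) : maxDomain q →ₗ[ℂ] L2R where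
  toFun y := MemLp.toLp (y : ℝ → ℂ) y.2.memLp
  map_add' y z := MemLp.toLp_add y.2.memLp z.2.memLp
  map_smul' c y := MemLp.toLp_const_smul c y.2.memLp

/-- `y ↦ τ_q y` as a map from the maximal domain to `L²(ℝ)`. -/
def tauL2 (q : ℝ → ℝ) : maxDomain q →ₗ[ℂ] L2R where
  toFun y := MemLp.toLp (tau q y) y.2.memLp_tau
  map_add' y z := by
    rw [← MemLp.toLp_add y.2.memLp_tau z.2.memLp_tau]
    exact MemLp.toLp_congr _ _ (tau_add_ae q y.2.ac z.2.ac)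
  map_smul' c y := by
    rw [RingHom.id_apply, ← MemLp.toLp_const_smul c y.2.memLp_tau]
    exact MemLp.toLp_congr _ _ (by
      rw [show ((c • y : maxDomain q) : ℝ → ℂ) = c • (y : ℝ → ℂ) from rfl, tau_smul q c y.2.ac])

theorem toL2_injective (q : ℝ → ℝ) : Function.Injective (toL2 q) := by
  intro y z h
  have h' : (y : ℝ → ℂ) =ᵐ[volume] (z : ℝ → ℂ) :=
    (MemLp.toLp_eq_toLp_iff y.2.memLp z.2.memLp).1 h
  exact Subtype.ext
    ((y.2.ac.diff.continuous.ae_eq_iff_eq volume z.2.ac.diff.continuous).1 h')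

/-- The maximal operator `A_max`: it sends the class of `y ∈ D_max` to the class of `τ_q y`. -/
def maxOp (q : ℝ → ℝ) : L2R →ₗ.[ℂ] L2R where
  domain := LinearMap.range (toL2 q)
  toFun := tauL2 q ∘ₗ
    (LinearEquiv.ofInjective (toL2 q) (toL2_injective q)).symm.toLinearMap

theorem maxOp_apply (q : ℝ → ℝ) (y : maxDomain q) :
    maxOp q ⟨toL2 q y, LinearMap.mem_range_self _ y⟩ = tauL2 q y := by
  change tauL2 q ((LinearEquiv.ofInjective (toL2 q) (toL2_injective q)).symm _) = _
  congr 1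
  exact (LinearEquiv.symm_apply_eq _).2 rfl

/-- The functions of the maximal domain that have compact support. -/
def compactDomain (q : ℝ → ℝ) : Submodule ℂ (maxDomain q) where
  carrier := {y | HasCompactSupport (y : ℝ → ℂ)}
  zero_mem' := HasCompactSupport.zero
  add_mem' hy hz := HasCompactSupport.add hy hz
  smul_mem' c _ hy := HasCompactSupport.smul_left (f := fun _ : ℝ => c) hy

/-- The pre-minimal operator `A₀`. -/
def preminOp (q : ℝ → ℝ) : L2R →ₗ.[ℂ] L2R :=
  (maxOp q).domRestrict ((compactDomain q).map (toL2 q))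

/-- The minimal operator `A`, the closure of `A₀`. -/
def minOp (q : ℝ → ℝ) : L2R →ₗ.[ℂ] L2R := (preminOp q).closure

/-- `T` is a bi-extension of `A`: a closed operator with `A ⊆ T ⊆ A*`. -/
structure IsBiExtension (A T : L2R →ₗ.[ℂ] L2R) : Prop where
  closed : T.IsClosed
  le : A ≤ T
  le_adjoint : T ≤ A†

/-- The parity operator `(P f)(x) = f(-x)` on `L²(ℝ)`. -/
def parity : L2R →ₗ[ℂ] L2R :=
  Lp.compMeasurePreservingₗ ℂ (fun x : ℝ => -x) (Measure.measurePreserving_neg volume)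

/-- The adjoint `T⁺ = P T* P` in the Krein space `(L²(ℝ), [·,·])`,
`[f,g] = ∫ f(x) conj (g(-x)) dx`, whose fundamental symmetry is the parity `P`. -/
def kreinAdjoint (T : L2R →ₗ.[ℂ] L2R) : L2R →ₗ.[ℂ] L2R where
  domain := (T†).domain.comap parity
  toFun := parity ∘ₗ (T†).toFun ∘ₗ
    parity.restrict (p := (T†).domain.comap parity) (q := (T†).domain) (fun _ h => h)

/-- `[f,g]_x = conj (f x) g'(x) - conj (f'(x)) g(x)`. -/
def bracket (f g : ℝ → ℂ) (x : ℝ) : ℂ :=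
  conj (f x) * deriv g x - conj (deriv f x) * g x

/-- `[f,g]_{+∞}`. -/
def bracketTop (f g : ℝ → ℂ) : ℂ := limUnder atTop (bracket f g)

/-- `[f,g]_{-∞}`. -/
def bracketBot (f g : ℝ → ℂ) : ℂ := limUnder atBot (bracket f g)

/-- The normalized pair of real solutions `w₁` (odd), `w₂` (even) in `D_max` of `τ_q y = 0`. -/
structure IsBoundaryPair (q : ℝ → ℝ) (w₁ w₂ : ℝ → ℂ) : Prop where
  mem₁ : w₁ ∈ maxDomain q
  mem₂ : w₂ ∈ maxDomain q
  sol₁ : IsSolution q 0 w₁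
  sol₂ : IsSolution q 0 w₂
  real₁ : ∀ x, (w₁ x).im = 0
  real₂ : ∀ x, (w₂ x).im = 0
  odd₁ : Function.Odd w₁
  even₂ : Function.Even w₂
  tendsto_top : Tendsto (bracket w₁ w₂) atTop (𝓝 1)
  tendsto_bot : Tendsto (bracket w₁ w₂) atBot (𝓝 1)

end PTSymm

end

open PTSymm

/-!
By Green's formula, `g` lies in the domain of `T†` exactly when `[g, f]_{-∞} = [g, f]_∞` for all `f`
in the domain of `T`, provided that `T†` is a restriction of the maximal operator. That proviso is
the regularity of weak solutions: if `h` satisfies `τ_q h = k` tested against all compactly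
supported functions of the maximal domain, then `h` differs on every bounded interval from a
variation of parameters solution by a combination of `w₁` and `w₂`.

Since `w₁` and `w₂` have Wronskian `1`, Plücker's identity expresses `[g, f]_{±∞}` through the
boundary values of `f` and `g` with respect to `w₁` and `w₂`. These four boundary values can be
prescribed arbitrarily, so `T†` is described by the annihilator of a line in `ℂ⁴` for a symplectic
form. Reflection exchanges the two ends and acts on the boundary values with a sign given by the
parity of `w₁` and `w₂`.
-/

namespace PTSymm

/-! ### Locally absolutely continuous functions -/

theorem absolutelyContinuousOnInterval_comp_lipschitzWith {X Y : Type*} [PseudoMetricSpace X]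
    [PseudoMetricSpace Y] {φ : X → Y} {K : NNReal} (hφ : LipschitzWith K φ) {f : ℝ → X} {a b : ℝ}
    (hf : AbsolutelyContinuousOnInterval f a b) :
    AbsolutelyContinuousOnInterval (φ ∘ f) a b := by
  refine squeeze_zero (fun _ => Finset.sum_nonneg fun _ _ => dist_nonneg) (fun E => ?_)
    (by simpa only [mul_zero] using Tendsto.const_mul (K : ℝ) hf)
  rw [Finset.mul_sum]
  exact Finset.sum_le_sum fun _ _ => hφ.dist_le_mul _ _

theorem absolutelyContinuousOnInterval_comp_neg {X : Type*} [PseudoMetricSpace X] {f : ℝ → X}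
    {a b : ℝ} (hf : AbsolutelyContinuousOnInterval f (-a) (-b)) :
    AbsolutelyContinuousOnInterval (fun x => f (-x)) a b := by
  rw [absolutelyContinuousOnInterval_iff] at hf ⊢
  intro ε hε
  obtain ⟨δ, hδ, h⟩ := hf ε hε
  refine ⟨δ, hδ, fun E hE hlen => ?_⟩
  refine h (E.1, fun i => (-(E.2 i).1, -(E.2 i).2)) ⟨fun i hi => ?_, fun i hi j hj hij => ?_⟩
    (by simpa only [dist_neg_neg] using hlen)
  · have := hE.1 i hi
    grind [Set.mem_uIcc]
  · have := hE.2 hi hj hij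
    simp only [Function.onFun, Set.uIoc, Set.Ioc_disjoint_Ioc] at this ⊢
    simpa only [max_neg_neg, min_neg_neg, neg_le_neg_iff] using this

theorem intervalIntegrable_of_locallyIntegrable {E : Type*} [NormedAddCommGroup E] {f : ℝ → E}
    (hf : LocallyIntegrable f volume) (a b : ℝ) : IntervalIntegrable f volume a b :=
  (hf.integrableOn_isCompact isCompact_uIcc).intervalIntegrable

theorem absolutelyContinuousOnInterval_integral {f : ℝ → ℝ} (hf : LocallyIntegrable f volume)
    (c a b : ℝ) : AbsolutelyContinuousOnInterval (fun x => ∫ t in c..x, f t) a b := by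
  have h := (intervalIntegrable_of_locallyIntegrable hf (min c (min a b))
    (max c (max a b))).absolutelyContinuousOnInterval_intervalIntegral (c := c)
    (by rw [Set.uIcc_of_le (by simp)]; simp)
  refine h.mono ?_
  rw [Set.uIcc_of_le (a := min c _) (by simp)]
  exact Set.Icc_subset_Icc (by simp) (by simp)

namespace ACLoc

variable {f g F : ℝ → ℂ}

theorem continuous (hf : ACLoc f) : Continuous f := by
  refine continuous_iff_continuousAt.2 fun x => ?_
  refine (hf (x - 1) (x + 1)).continuousOn.continuousAt ?_
  rw [Set.uIcc_of_le (by linarith)]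
  exact Icc_mem_nhds (by linarith) (by linarith)

theorem const (c : ℂ) : ACLoc fun _ => c :=
  fun _ _ => contDiff_const.contDiffOn.absolutelyContinuousOnInterval

theorem add (hf : ACLoc f) (hg : ACLoc g) : ACLoc fun x => f x + g x :=
  fun a b => (hf a b).add (hg a b)

theorem neg (hf : ACLoc f) : ACLoc fun x => -f x :=
  fun a b => (hf a b).neg

theorem sub (hf : ACLoc f) (hg : ACLoc g) : ACLoc fun x => f x - g x :=
  fun a b => (hf a b).sub (hg a b)

theorem mul (hf : ACLoc f) (hg : ACLoc g) : ACLoc fun x => f x * g x :=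
  fun a b => (hf a b).smul (hg a b)

theorem star (hf : ACLoc f) : ACLoc fun x => conj (f x) := fun a b =>
  absolutelyContinuousOnInterval_comp_lipschitzWith Complex.isometry_conj.lipschitz (hf a b)

theorem comp_neg (hf : ACLoc f) : ACLoc fun x => f (-x) := fun a b =>
  absolutelyContinuousOnInterval_comp_neg (hf (-a) (-b))

theorem ofReal {f : ℝ → ℝ} (hf : ∀ a b, AbsolutelyContinuousOnInterval f a b) :
    ACLoc fun x => (f x : ℂ) := fun a b =>
  absolutelyContinuousOnInterval_comp_lipschitzWith Complex.isometry_ofReal.lipschitz (hf a b)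

theorem integral (hf : LocallyIntegrable f volume) (c : ℝ) : ACLoc fun x => ∫ t in c..x, f t := by
  have hre : LocallyIntegrable (fun x => (f x).re) volume :=
    fun x => (hf x).imp fun _ h => ⟨h.1, h.2.re⟩
  have him : LocallyIntegrable (fun x => (f x).im) volume :=
    fun x => (hf x).imp fun _ h => ⟨h.1, h.2.im⟩
  have h := (ofReal (absolutelyContinuousOnInterval_integral hre c)).add
    ((const Complex.I).mul (ofReal (absolutelyContinuousOnInterval_integral him c)))
  convert h using 2 with x
  have hi := intervalIntegrable_of_locallyIntegrable hf c x
  have h_re := Complex.reCLM.intervalIntegral_comp_comm hi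
  have h_im := Complex.imCLM.intervalIntegral_comp_comm hi
  simp only [Complex.reCLM_apply, Complex.imCLM_apply] at h_re h_im
  rw [h_re, h_im, mul_comm, Complex.re_add_im]

theorem intervalIntegrable_of_ae_hasDerivAt (hF : ACLoc F) (hd : ∀ᵐ x, HasDerivAt F (f x) x)
    (a b : ℝ) : IntervalIntegrable f volume a b := by
  have part : ∀ L : ℂ →L[ℝ] ℝ, IntervalIntegrable (fun x => L (f x)) volume a b := fun L => by
    refine (absolutelyContinuousOnInterval_comp_lipschitzWith L.lipschitz
      (hF a b)).intervalIntegrable_deriv.congr_ae (ae_restrict_of_ae ?_)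
    filter_upwards [hd] with x hx
    exact (L.hasFDerivAt.comp_hasDerivAt x hx).deriv
  rw [intervalIntegrable_iff]
  exact Integrable.re_im_iff.1 ⟨(part Complex.reCLM).def', (part Complex.imCLM).def'⟩

theorem integral_eq_sub (hF : ACLoc F) (hd : ∀ᵐ x, HasDerivAt F (f x) x) (a b : ℝ) :
    ∫ t in a..b, f t = F b - F a := by
  have part : ∀ L : ℂ →L[ℝ] ℝ, L (∫ t in a..b, f t) = L (F b) - L (F a) := fun L => by
    have h := (absolutelyContinuousOnInterval_comp_lipschitzWith L.lipschitz
      (hF a b)).integral_deriv_eq_sub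
    rw [← L.intervalIntegral_comp_comm (hF.intervalIntegrable_of_ae_hasDerivAt hd a b)]
    refine (intervalIntegral.integral_congr_ae ?_).trans h
    filter_upwards [hd] with x hx _
    exact (L.hasFDerivAt.comp_hasDerivAt x hx).deriv.symm
  exact Complex.ext (part Complex.reCLM) (part Complex.imCLM)

theorem hasDerivAt_of_ae (hF : ACLoc F) (hf : Continuous f) (hd : ∀ᵐ x, HasDerivAt F (f x) x)
    (x : ℝ) : HasDerivAt F (f x) x := by
  have h : F = fun x => F 0 + ∫ t in (0 : ℝ)..x, f t :=
    funext fun x => by rw [hF.integral_eq_sub hd, add_sub_cancel]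
  rw [h]
  exact (hf.integral_hasStrictDerivAt 0 x).hasDerivAt.const_add _

theorem integral_eq_zero_of_hasCompactSupport (hF : ACLoc F) (hsupp : HasCompactSupport F)
    (hd : ∀ᵐ x, HasDerivAt F (f x) x) : ∫ t, f t = 0 := by
  obtain ⟨R, hR⟩ := hsupp.isCompact.isBounded.subset_ball 0
  have hsub : tsupport F ⊆ Set.Ioo (-R) R := by simpa [Real.ball_eq_Ioo] using hR
  have hF_zero : ∀ x ∉ Set.Ioo (-R) R, F x = 0 := fun x hx =>
    image_eq_zero_of_notMem_tsupport fun h => hx (hsub h)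
  have hderiv : f =ᵐ[volume] deriv F := hd.mono fun x hx => hx.deriv.symm
  calc ∫ t, f t = ∫ t, deriv F t := integral_congr_ae hderiv
    _ = ∫ t in (-R)..R, deriv F t := (intervalIntegral.integral_eq_integral_of_support_subset
        ((support_deriv_subset.trans hsub).trans Set.Ioo_subset_Ioc_self)).symm
    _ = ∫ t in (-R)..R, f t :=
        intervalIntegral.integral_congr_ae (hderiv.mono fun _ hx _ => hx.symm)
    _ = 0 := by
      rw [hF.integral_eq_sub hd, hF_zero R (by simp), hF_zero (-R) (by simp), sub_zero]

end ACLoc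

namespace IsACTwo

variable {y v : ℝ → ℂ}

theorem continuous (hy : IsACTwo y) : Continuous y := hy.diff.continuous

theorem hasDerivAt (hy : IsACTwo y) (x : ℝ) : HasDerivAt y (deriv y x) x :=
  (hy.diff x).hasDerivAt

theorem ae_hasDerivAt_deriv (q : ℝ → ℝ) (hy : IsACTwo y) :
    ∀ᵐ x, HasDerivAt (deriv y) (-tau q y x - q x * y x) x := by
  filter_upwards [hy.ac_deriv.ae_differentiableAt] with x hx
  refine hx.hasDerivAt.congr_deriv ?_
  rw [tau]
  ring

theorem of_ae_hasDerivAt (hy : ACLoc y) (hv : ACLoc v) (hd : ∀ᵐ x, HasDerivAt y (v x) x) :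
    IsACTwo y ∧ deriv y = v := by
  have h := hy.hasDerivAt_of_ae hv.continuous hd
  have hdv : deriv y = v := funext fun x => (h x).deriv
  exact ⟨⟨fun x => (h x).differentiableAt, hy, hdv ▸ hv⟩, hdv⟩

end IsACTwo

/-! ### The Lagrange bracket and Green's formula -/

section Green

variable {q : ℝ → ℝ} {f g : ℝ → ℂ}

theorem acLoc_bracket (hf : IsACTwo f) (hg : IsACTwo g) : ACLoc (bracket f g) :=
  (hf.ac.star.mul hg.ac_deriv).sub (hf.ac_deriv.star.mul hg.ac)

theorem ae_hasDerivAt_bracket (q : ℝ → ℝ) (hf : IsACTwo f) (hg : IsACTwo g) :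
    ∀ᵐ x, HasDerivAt (bracket f g) (conj (tau q f x) * g x - conj (f x) * tau q g x) x := by
  filter_upwards [hf.ae_hasDerivAt_deriv q, hg.ae_hasDerivAt_deriv q] with x hf'' hg''
  refine (((hf.hasDerivAt x).star.mul hg'').sub (hf''.star.mul (hg.hasDerivAt x))).congr_deriv ?_
  simp only [Complex.star_def, map_sub, map_neg, map_mul, Complex.conj_ofReal]
  ring

theorem bracket_sub_bracket (q : ℝ → ℝ) (hf : IsACTwo f) (hg : IsACTwo g) (a b : ℝ) :
    bracket f g b - bracket f g a =
      ∫ t in a..b, (conj (tau q f t) * g t - conj (f t) * tau q g t) :=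
  ((acLoc_bracket hf hg).integral_eq_sub (ae_hasDerivAt_bracket q hf hg) a b).symm

theorem integrable_conj_mul {α : Type*} [MeasurableSpace α] {μ : Measure α} {f g : α → ℂ}
    (hf : MemLp f 2 μ) (hg : MemLp g 2 μ) : Integrable (fun x => conj (f x) * g x) μ :=
  hf.star.integrable_mul hg

theorem inner_toLp {α : Type*} [MeasurableSpace α] {μ : Measure α} {f g : α → ℂ}
    (hf : MemLp f 2 μ) (hg : MemLp g 2 μ) :
    inner ℂ (hf.toLp f) (hg.toLp g) = ∫ x, conj (f x) * g x ∂μ := by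
  rw [L2.inner_def]
  refine integral_congr_ae ?_
  filter_upwards [hf.coeFn_toLp, hg.coeFn_toLp] with x hfx hgx
  rw [hfx, hgx, RCLike.inner_apply, mul_comm]

namespace InMaxDomain

theorem integrable_green (hf : InMaxDomain q f) (hg : InMaxDomain q g) :
    Integrable (fun t => conj (tau q f t) * g t - conj (f t) * tau q g t) volume :=
  (integrable_conj_mul hf.memLp_tau hg.memLp).sub (integrable_conj_mul hf.memLp hg.memLp_tau)

theorem tendsto_bracketTop (hf : InMaxDomain q f) (hg : InMaxDomain q g) :
    Tendsto (bracket f g) atTop (𝓝 (bracketTop f g)) := by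
  have h := intervalIntegral_tendsto_integral_Ioi (0 : ℝ)
    (hf.integrable_green hg).integrableOn tendsto_id
  refine tendsto_nhds_limUnder ⟨_, (h.const_add (bracket f g 0)).congr fun x => ?_⟩
  rw [id, ← bracket_sub_bracket q hf.ac hg.ac, add_sub_cancel]

theorem tendsto_bracketBot (hf : InMaxDomain q f) (hg : InMaxDomain q g) :
    Tendsto (bracket f g) atBot (𝓝 (bracketBot f g)) := by
  have h := intervalIntegral_tendsto_integral_Iic (0 : ℝ)
    (hf.integrable_green hg).integrableOn tendsto_id
  refine tendsto_nhds_limUnder ⟨_, (h.const_sub (bracket f g 0)).congr fun x => ?_⟩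
  rw [id, ← bracket_sub_bracket q hf.ac hg.ac, sub_sub_cancel]

theorem bracketTop_sub_bracketBot (hf : InMaxDomain q f) (hg : InMaxDomain q g) :
    bracketTop f g - bracketBot f g =
      ∫ t, (conj (tau q f t) * g t - conj (f t) * tau q g t) := by
  refine tendsto_nhds_unique ?_ (intervalIntegral_tendsto_integral (hf.integrable_green hg)
    tendsto_neg_atTop_atBot tendsto_id)
  refine ((hf.tendsto_bracketTop hg).sub
    ((hf.tendsto_bracketBot hg).comp tendsto_neg_atTop_atBot)).congr fun x => ?_
  rw [id, ← bracket_sub_bracket q hf.ac hg.ac, Function.comp_apply]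

end InMaxDomain

theorem inner_tauL2_sub_inner_toL2 (q : ℝ → ℝ) (f g : maxDomain q) :
    inner ℂ (tauL2 q f) (toL2 q g) - inner ℂ (toL2 q f) (tauL2 q g) =
      bracketTop f g - bracketBot f g := by
  have h_tau_left : inner ℂ (tauL2 q f) (toL2 q g) = ∫ x, conj (tau q f x) * (g : ℝ → ℂ) x :=
    inner_toLp f.2.memLp_tau g.2.memLp
  have h_tau_right : inner ℂ (toL2 q f) (tauL2 q g) = ∫ x, conj ((f : ℝ → ℂ) x) * tau q g x :=
    inner_toLp f.2.memLp g.2.memLp_tau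
  rw [h_tau_left, h_tau_right, ← integral_sub (integrable_conj_mul f.2.memLp_tau g.2.memLp)
    (integrable_conj_mul f.2.memLp g.2.memLp_tau),
    InMaxDomain.bracketTop_sub_bracketBot f.2 g.2]

theorem hasCompactSupport_tau (q : ℝ → ℝ) (hsupp : HasCompactSupport f) :
    HasCompactSupport (tau q f) :=
  hsupp.deriv.deriv.neg.sub hsupp.mul_left

theorem integrable_conj_mul_tau (hf : Continuous f) (hg : InMaxDomain q g)
    (hsupp : HasCompactSupport g) : Integrable (fun t => conj (f t) * tau q g t) volume := by
  have hloc : LocallyIntegrable (fun t => conj (f t) * tau q g t) volume :=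
    (hg.memLp_tau.locallyIntegrable one_le_two).continuous_mul hf.star
  exact (integrableOn_iff_integrable_of_support_subset (subset_tsupport _)).1
    (hloc.integrableOn_isCompact (hasCompactSupport_tau q hsupp).mul_left)

theorem integral_conj_tau_mul (hf : IsACTwo f) (hτf : MemLp (tau q f) 2 volume)
    (hg : InMaxDomain q g) (hsupp : HasCompactSupport g) :
    ∫ t, conj (tau q f t) * g t = ∫ t, conj (f t) * tau q g t := by
  rw [← sub_eq_zero, ← integral_sub (integrable_conj_mul hτf hg.memLp)
    (integrable_conj_mul_tau hf.continuous hg hsupp)]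
  exact (acLoc_bracket hf hg.ac).integral_eq_zero_of_hasCompactSupport
    (hsupp.deriv.mul_left.sub hsupp.mul_left) (ae_hasDerivAt_bracket q hf hg.ac)

end Green

/-! ### Fundamental pairs and variation of parameters -/

/-- A real fundamental system of `τ_q y = 0` with Wronskian `1`. Unlike `IsBoundaryPair`, it
requires neither square integrability nor parity. -/
structure IsFundamentalPair (q : ℝ → ℝ) (w₁ w₂ : ℝ → ℂ) : Prop where
  sol₁ : IsSolution q 0 w₁
  sol₂ : IsSolution q 0 w₂
  real₁ : ∀ x, (w₁ x).im = 0
  real₂ : ∀ x, (w₂ x).im = 0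
  wronskian : ∀ x, w₁ x * deriv w₂ x - deriv w₁ x * w₂ x = 1

/-- The solution `u` of `τ_q u = k` obtained by variation of parameters from the base point `c`,
normalized by `u c = a * w₁ c + b * w₂ c` and `u' c = a * w₁' c + b * w₂' c`. -/
noncomputable def variation (w₁ w₂ k : ℝ → ℂ) (c : ℝ) (a b : ℂ) (x : ℝ) : ℂ :=
  (a + ∫ t in c..x, w₂ t * k t) * w₁ x + (b - ∫ t in c..x, w₁ t * k t) * w₂ x

theorem conj_deriv_eq_self {w : ℝ → ℂ} (h : ∀ x, (w x).im = 0) (x : ℝ) :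
    conj (deriv w x) = deriv w x := by
  have hw : (fun t => star (w t)) = w := funext fun t => Complex.conj_eq_iff_im.2 (h t)
  rw [← Complex.star_def, ← deriv.star, hw]

theorem bracket_eq_of_im_eq_zero {w : ℝ → ℂ} (h : ∀ x, (w x).im = 0) (f : ℝ → ℂ) (x : ℝ) :
    bracket w f x = w x * deriv f x - deriv w x * f x := by
  rw [bracket, Complex.conj_eq_iff_im.2 (h x), conj_deriv_eq_self h]

theorem IsSolution.ae_tau_eq_zero {q : ℝ → ℝ} {y : ℝ → ℂ} (h : IsSolution q 0 y) :
    ∀ᵐ x, tau q y x = 0 := by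
  simpa only [zero_mul, sub_zero] using h.2

theorem IsBoundaryPair.isFundamentalPair {q : ℝ → ℝ} {w₁ w₂ : ℝ → ℂ}
    (hw : IsBoundaryPair q w₁ w₂) : IsFundamentalPair q w₁ w₂ where
  sol₁ := hw.sol₁
  sol₂ := hw.sol₂
  real₁ := hw.real₁
  real₂ := hw.real₂
  wronskian x := by
    rw [← bracket_eq_of_im_eq_zero hw.real₁]
    refine tendsto_nhds_unique (tendsto_const_nhds.congr fun t => ?_) hw.tendsto_top
    rw [eq_comm, ← sub_eq_zero, bracket_sub_bracket q hw.sol₁.1 hw.sol₂.1]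
    refine intervalIntegral.integral_zero_ae ?_
    filter_upwards [hw.sol₁.ae_tau_eq_zero, hw.sol₂.ae_tau_eq_zero] with s h₁ h₂ _
    rw [h₁, h₂, map_zero, zero_mul, mul_zero, sub_zero]

namespace IsFundamentalPair

variable {q : ℝ → ℝ} {w₁ w₂ k : ℝ → ℂ}

theorem continuous₁ (hw : IsFundamentalPair q w₁ w₂) : Continuous w₁ := hw.sol₁.1.continuous

theorem continuous₂ (hw : IsFundamentalPair q w₁ w₂) : Continuous w₂ := hw.sol₂.1.continuous

theorem bracket_eq (hw : IsFundamentalPair q w₁ w₂) (f g : ℝ → ℂ) (x : ℝ) :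
    bracket f g x = conj (bracket w₁ f x) * bracket w₂ g x -
      conj (bracket w₂ f x) * bracket w₁ g x := by
  simp only [bracket, map_sub, map_mul, Complex.conj_eq_iff_im.2 (hw.real₁ x),
    Complex.conj_eq_iff_im.2 (hw.real₂ x), conj_deriv_eq_self hw.real₁,
    conj_deriv_eq_self hw.real₂]
  linear_combination -(conj (f x) * deriv g x - conj (deriv f x) * g x) * hw.wronskian x

theorem tendsto_bracket (hw : IsFundamentalPair q w₁ w₂) {l : Filter ℝ} {f g : ℝ → ℂ}
    {a₁ a₂ b₁ b₂ : ℂ} (hf₁ : Tendsto (bracket w₁ f) l (𝓝 a₁))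
    (hf₂ : Tendsto (bracket w₂ f) l (𝓝 a₂)) (hg₁ : Tendsto (bracket w₁ g) l (𝓝 b₁))
    (hg₂ : Tendsto (bracket w₂ g) l (𝓝 b₂)) :
    Tendsto (bracket f g) l (𝓝 (conj a₁ * b₂ - conj a₂ * b₁)) :=
  ((hf₁.star.mul hg₂).sub (hf₂.star.mul hg₁)).congr fun x => (hw.bracket_eq f g x).symm

theorem locallyIntegrable_mul₁ (hw : IsFundamentalPair q w₁ w₂)
    (hk : LocallyIntegrable k volume) : LocallyIntegrable (fun t => w₁ t * k t) volume :=
  hk.continuous_mul hw.continuous₁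

theorem locallyIntegrable_mul₂ (hw : IsFundamentalPair q w₁ w₂)
    (hk : LocallyIntegrable k volume) : LocallyIntegrable (fun t => w₂ t * k t) volume :=
  hk.continuous_mul hw.continuous₂

theorem ae_tau_eq_of_ae_hasDerivAt (hw : IsFundamentalPair q w₁ w₂) {A B : ℝ → ℂ} (hA : ACLoc A)
    (hB : ACLoc B) (hA' : ∀ᵐ x, HasDerivAt A (w₂ x * k x) x)
    (hB' : ∀ᵐ x, HasDerivAt B (-(w₁ x * k x)) x) :
    IsACTwo (fun x => A x * w₁ x + B x * w₂ x) ∧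
      (deriv fun x => A x * w₁ x + B x * w₂ x) =
        (fun x => A x * deriv w₁ x + B x * deriv w₂ x) ∧
      tau q (fun x => A x * w₁ x + B x * w₂ x) =ᵐ[volume] k := by
  obtain ⟨hac, hderiv⟩ := IsACTwo.of_ae_hasDerivAt
    ((hA.mul hw.sol₁.1.ac).add (hB.mul hw.sol₂.1.ac))
    ((hA.mul hw.sol₁.1.ac_deriv).add (hB.mul hw.sol₂.1.ac_deriv)) (by
      filter_upwards [hA', hB'] with x hAx hBx
      refine ((hAx.mul (hw.sol₁.1.hasDerivAt x)).add
        (hBx.mul (hw.sol₂.1.hasDerivAt x))).congr_deriv ?_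
      ring)
  refine ⟨hac, hderiv, ?_⟩
  filter_upwards [hA', hB', hw.sol₁.1.ae_hasDerivAt_deriv q, hw.sol₂.1.ae_hasDerivAt_deriv q,
    hw.sol₁.ae_tau_eq_zero, hw.sol₂.ae_tau_eq_zero] with x hAx hBx hw₁'' hw₂'' h₁ h₂
  have hd : deriv (fun x => A x * deriv w₁ x + B x * deriv w₂ x) x = _ :=
    ((hAx.mul hw₁'').add (hBx.mul hw₂'')).deriv
  rw [tau, hderiv, hd, h₁, h₂]
  linear_combination k x * hw.wronskian x

theorem variation_spec (hw : IsFundamentalPair q w₁ w₂) (hk : LocallyIntegrable k volume) (c : ℝ)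
    (a b : ℂ) : IsACTwo (variation w₁ w₂ k c a b) ∧
      deriv (variation w₁ w₂ k c a b) = (fun x => (a + ∫ t in c..x, w₂ t * k t) * deriv w₁ x +
        (b - ∫ t in c..x, w₁ t * k t) * deriv w₂ x) ∧
      tau q (variation w₁ w₂ k c a b) =ᵐ[volume] k := by
  have h₁ := hw.locallyIntegrable_mul₁ hk
  have h₂ := hw.locallyIntegrable_mul₂ hk
  refine hw.ae_tau_eq_of_ae_hasDerivAt ((ACLoc.const a).add (ACLoc.integral h₂ c))
    ((ACLoc.const b).sub (ACLoc.integral h₁ c)) ?_ ?_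
  · filter_upwards [_root_.LocallyIntegrable.ae_hasDerivAt_integral h₂] with x hx
    exact (hx c).const_add a
  · filter_upwards [_root_.LocallyIntegrable.ae_hasDerivAt_integral h₁] with x hx
    exact (hx c).const_sub b

theorem isACTwo_variation (hw : IsFundamentalPair q w₁ w₂) (hk : LocallyIntegrable k volume)
    (c : ℝ) (a b : ℂ) : IsACTwo (variation w₁ w₂ k c a b) :=
  (hw.variation_spec hk c a b).1

theorem tau_variation_ae_eq (hw : IsFundamentalPair q w₁ w₂) (hk : LocallyIntegrable k volume)
    (c : ℝ) (a b : ℂ) : tau q (variation w₁ w₂ k c a b) =ᵐ[volume] k :=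
  (hw.variation_spec hk c a b).2.2

theorem bracket₁_variation (hw : IsFundamentalPair q w₁ w₂) (hk : LocallyIntegrable k volume)
    (c : ℝ) (a b : ℂ) (x : ℝ) :
    bracket w₁ (variation w₁ w₂ k c a b) x = b - ∫ t in c..x, w₁ t * k t := by
  rw [bracket_eq_of_im_eq_zero hw.real₁, (hw.variation_spec hk c a b).2.1, variation]
  linear_combination (b - ∫ t in c..x, w₁ t * k t) * hw.wronskian x

theorem bracket₂_variation (hw : IsFundamentalPair q w₁ w₂) (hk : LocallyIntegrable k volume)
    (c : ℝ) (a b : ℂ) (x : ℝ) :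
    bracket w₂ (variation w₁ w₂ k c a b) x = -(a + ∫ t in c..x, w₂ t * k t) := by
  rw [bracket_eq_of_im_eq_zero hw.real₂, (hw.variation_spec hk c a b).2.1, variation]
  linear_combination -(a + ∫ t in c..x, w₂ t * k t) * hw.wronskian x

end IsFundamentalPair

section Support

variable {f : ℝ → ℂ} {a b x : ℝ}

theorem integral_eq_zero_of_le_of_support_subset (hf : Function.support f ⊆ Set.Ioc a b)
    (hx : x ≤ a) : ∫ t in a..x, f t = 0 := by
  refine intervalIntegral.integral_zero_ae (Eventually.of_forall fun t ht => ?_)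
  rw [Set.uIoc_of_ge hx] at ht
  exact Function.notMem_support.1 fun h => (hf h).1.not_ge ht.2

theorem integral_eq_integral_of_ge_of_support_subset (hf : Function.support f ⊆ Set.Ioc a b)
    (hx : b ≤ x) : ∫ t in a..x, f t = ∫ t, f t :=
  intervalIntegral.integral_eq_integral_of_support_subset
    (hf.trans (Set.Ioc_subset_Ioc_right hx))

theorem norm_intervalIntegral_le_integral_norm (hf : Integrable f volume) (a b : ℝ) :
    ‖∫ t in a..b, f t‖ ≤ ∫ t, ‖f t‖ :=
  intervalIntegral.norm_integral_le_integral_norm_uIoc.trans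
    (setIntegral_le_integral hf.norm (Eventually.of_forall fun _ => norm_nonneg _))

end Support

namespace IsFundamentalPair

variable {q : ℝ → ℝ} {w₁ w₂ k : ℝ → ℂ} {a b : ℝ}

theorem inMaxDomain_variation (hw : IsFundamentalPair q w₁ w₂) (hw₁ : MemLp w₁ 2 volume)
    (hw₂ : MemLp w₂ 2 volume) (hk : MemLp k 2 volume) (c : ℝ) (s₁ s₂ : ℂ) :
    InMaxDomain q (variation w₁ w₂ k c s₁ s₂) := by
  have hloc := hk.locallyIntegrable one_le_two
  have memLp_mul {A w : ℝ → ℂ} {C : ℝ} (hA : Continuous A) (hw : MemLp w 2 volume)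
      (hC : ∀ x, ‖A x‖ ≤ C) : MemLp (fun x => A x * w x) 2 volume :=
    hw.of_le_mul (hA.aestronglyMeasurable.mul hw.1) <| Eventually.of_forall fun x =>
      (norm_mul_le _ _).trans (by gcongr; exact hC x)
  refine ⟨hw.isACTwo_variation hloc c s₁ s₂, ?_,
    hk.ae_eq (hw.tau_variation_ae_eq hloc c s₁ s₂).symm⟩
  refine MemLp.add (memLp_mul (C := ‖s₁‖ + ∫ t, ‖w₂ t * k t‖) ?_ hw₁ fun x => ?_)
    (memLp_mul (C := ‖s₂‖ + ∫ t, ‖w₁ t * k t‖) ?_ hw₂ fun x => ?_)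
  · exact continuous_const.add (ACLoc.integral (hw.locallyIntegrable_mul₂ hloc) c).continuous
  · exact (norm_add_le _ _).trans (add_le_add_right
      (norm_intervalIntegral_le_integral_norm (hw₂.integrable_mul hk) c x) _)
  · exact continuous_const.sub (ACLoc.integral (hw.locallyIntegrable_mul₁ hloc) c).continuous
  · exact (norm_sub_le _ _).trans (add_le_add_right
      (norm_intervalIntegral_le_integral_norm (hw₁.integrable_mul hk) c x) _)

theorem exists_compactDomain_tau_ae_eq (hw : IsFundamentalPair q w₁ w₂) (hk : MemLp k 2 volume)
    (hsupp : Function.support k ⊆ Set.Ioc a b) (h₁ : ∫ t, w₁ t * k t = 0)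
    (h₂ : ∫ t, w₂ t * k t = 0) : ∃ y ∈ compactDomain q, tau q y =ᵐ[volume] k := by
  have hloc := hk.locallyIntegrable one_le_two
  have supp₁ : Function.support (fun t => w₁ t * k t) ⊆ Set.Ioc a b :=
    (Function.support_mul_subset_right _ _).trans hsupp
  have supp₂ : Function.support (fun t => w₂ t * k t) ⊆ Set.Ioc a b :=
    (Function.support_mul_subset_right _ _).trans hsupp
  have hac := hw.isACTwo_variation hloc a 0 0
  have htau := hw.tau_variation_ae_eq hloc a 0 0
  have hcompact : HasCompactSupport (variation w₁ w₂ k a 0 0) := by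
    refine HasCompactSupport.intro (isCompact_Icc (a := a) (b := b)) fun x hx => ?_
    rw [Set.mem_Icc, not_and_or, not_le, not_le] at hx
    rcases hx with hx | hx
    · simp only [variation, integral_eq_zero_of_le_of_support_subset supp₁ hx.le,
        integral_eq_zero_of_le_of_support_subset supp₂ hx.le, add_zero, sub_zero, zero_mul]
    · simp only [variation, integral_eq_integral_of_ge_of_support_subset supp₁ hx.le,
        integral_eq_integral_of_ge_of_support_subset supp₂ hx.le, h₁, h₂, add_zero, sub_zero,
        zero_mul]
  exact ⟨⟨_, hac, hac.continuous.memLp_of_hasCompactSupport hcompact, hk.ae_eq htau.symm⟩,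
    hcompact, htau⟩

end IsFundamentalPair

/-! ### Weak solutions -/

theorem exists_forall_inner_eq {𝕜 E ι : Type*} [RCLike 𝕜] [NormedAddCommGroup E]
    [InnerProductSpace 𝕜 E] [Finite ι] {v : ι → E} (hv : LinearIndependent 𝕜 v) (c : ι → 𝕜) :
    ∃ x : E, ∀ i, inner 𝕜 (v i) x = c i := by
  classical
  cases nonempty_fintype ι
  have hdet : IsUnit (Matrix.gram 𝕜 v).det :=
    isUnit_iff_ne_zero.2 (Matrix.det_gram_ne_zero_iff_linearIndependent.2 hv)
  have hgram : Matrix.gram 𝕜 v *ᵥ ((Matrix.gram 𝕜 v)⁻¹ *ᵥ c) = c := by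
    rw [Matrix.mulVec_mulVec, Matrix.mul_nonsing_inv _ hdet, Matrix.one_mulVec]
  refine ⟨∑ j, ((Matrix.gram 𝕜 v)⁻¹ *ᵥ c) j • v j, fun i => ?_⟩
  simp only [inner_sum, inner_smul_right]
  conv_rhs => rw [← hgram]
  exact Finset.sum_congr rfl fun j _ => mul_comm _ _

theorem memLp_restrict_Ioc {E : Type*} [NormedAddCommGroup E] {f : ℝ → E} (hf : Continuous f)
    (p : ENNReal) (a b : ℝ) : MemLp f p (volume.restrict (Set.Ioc a b)) := by
  obtain ⟨C, hC⟩ := (isCompact_Icc (a := a) (b := b)).exists_bound_of_continuousOn hf.continuousOn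
  refine MemLp.of_bound hf.aestronglyMeasurable C ?_
  filter_upwards [ae_restrict_mem measurableSet_Ioc] with x hx
  exact hC x (Set.Ioc_subset_Icc_self hx)

theorem memLp_indicator_coeFn {α E : Type*} [MeasurableSpace α] {μ : Measure α}
    [NormedAddCommGroup E] {s : Set α} (hs : MeasurableSet s) {r : ENNReal}
    (p : Lp E r (μ.restrict s)) : MemLp (s.indicator p) r μ :=
  (memLp_indicator_iff_restrict hs).2 (Lp.memLp p)

theorem integral_conj_mul_indicator {α : Type*} [MeasurableSpace α] {μ : Measure α} {s : Set α}
    (hs : MeasurableSet s) {f : α → ℂ} (hf : MemLp f 2 (μ.restrict s))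
    (p : Lp ℂ 2 (μ.restrict s)) :
    ∫ x, conj (f x) * s.indicator p x ∂μ = inner ℂ (hf.toLp f) p := by
  conv_rhs => rw [← Lp.toLp_coeFn p (Lp.memLp p), inner_toLp hf (Lp.memLp p)]
  rw [← integral_indicator hs]
  exact integral_congr_ae (Eventually.of_forall fun x =>
    (Set.indicator_mul_right s (fun y => conj (f y)) p).symm)

namespace IsFundamentalPair

variable {q : ℝ → ℝ} {w₁ w₂ : ℝ → ℂ} {a b : ℝ}

theorem eq_zero_of_ae_eq_zero (hw : IsFundamentalPair q w₁ w₂) (hab : a < b) {c₁ c₂ : ℂ}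
    (h : ∀ᵐ x ∂volume.restrict (Set.Ioc a b), c₁ * w₁ x + c₂ * w₂ x = 0) : c₁ = 0 ∧ c₂ = 0 := by
  obtain ⟨x, hx⟩ := exists_between hab
  have hzero : Set.EqOn (fun x => c₁ * w₁ x + c₂ * w₂ x) (fun _ => 0) (Set.Ioc a b) :=
    Measure.eqOn_Ioc_of_ae_eq volume h
      ((continuous_const.mul hw.continuous₁).add
        (continuous_const.mul hw.continuous₂)).continuousOn continuousOn_const
  have hval : c₁ * w₁ x + c₂ * w₂ x = 0 := hzero ⟨hx.1, hx.2.le⟩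
  have hderiv : c₁ * deriv w₁ x + c₂ * deriv w₂ x = 0 := by
    have hd := ((hw.sol₁.1.hasDerivAt x).const_mul c₁).add ((hw.sol₂.1.hasDerivAt x).const_mul c₂)
    refine hd.unique ((hasDerivAt_const x (0 : ℂ)).congr_of_eventuallyEq ?_)
    filter_upwards [Ioc_mem_nhds hx.1 hx.2] with t ht using hzero ht
  exact ⟨by linear_combination deriv w₂ x * hval - w₂ x * hderiv - c₁ * hw.wronskian x,
    by linear_combination w₁ x * hderiv - deriv w₁ x * hval - c₂ * hw.wronskian x⟩

theorem linearIndependent_toLp (hw : IsFundamentalPair q w₁ w₂) (hab : a < b) :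
    LinearIndependent ℂ ![(memLp_restrict_Ioc hw.continuous₁ 2 a b).toLp w₁,
      (memLp_restrict_Ioc hw.continuous₂ 2 a b).toLp w₂] := by
  refine LinearIndependent.pair_iff.2 fun c₁ c₂ h => hw.eq_zero_of_ae_eq_zero hab ?_
  rw [← MemLp.toLp_const_smul, ← MemLp.toLp_const_smul, ← MemLp.toLp_add,
    Lp.eq_zero_iff_ae_eq_zero] at h
  exact (MemLp.coeFn_toLp _).symm.trans h

theorem integral_mul₁_indicator (hw : IsFundamentalPair q w₁ w₂)
    (p : Lp ℂ 2 (volume.restrict (Set.Ioc a b))) :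
    ∫ t, w₁ t * (Set.Ioc a b).indicator p t =
      inner ℂ ((memLp_restrict_Ioc hw.continuous₁ 2 a b).toLp w₁) p := by
  rw [← integral_conj_mul_indicator measurableSet_Ioc]
  simp only [Complex.conj_eq_iff_im.2 (hw.real₁ _)]

theorem integral_mul₂_indicator (hw : IsFundamentalPair q w₁ w₂)
    (p : Lp ℂ 2 (volume.restrict (Set.Ioc a b))) :
    ∫ t, w₂ t * (Set.Ioc a b).indicator p t =
      inner ℂ ((memLp_restrict_Ioc hw.continuous₂ 2 a b).toLp w₂) p := by
  rw [← integral_conj_mul_indicator measurableSet_Ioc]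
  simp only [Complex.conj_eq_iff_im.2 (hw.real₂ _)]

theorem exists_integral_mul_eq (hw : IsFundamentalPair q w₁ w₂) (hab : a < b) (c₁ c₂ : ℂ) :
    ∃ k : ℝ → ℂ, MemLp k 2 volume ∧ Function.support k ⊆ Set.Ioc a b ∧
      ∫ t, w₁ t * k t = c₁ ∧ ∫ t, w₂ t * k t = c₂ := by
  obtain ⟨p, hp⟩ := exists_forall_inner_eq (hw.linearIndependent_toLp hab) ![c₁, c₂]
  exact ⟨(Set.Ioc a b).indicator p, memLp_indicator_coeFn measurableSet_Ioc p,
    Set.support_indicator_subset, (hw.integral_mul₁_indicator p).trans (hp 0),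
    (hw.integral_mul₂_indicator p).trans (hp 1)⟩

end IsFundamentalPair

section Weak

variable {q : ℝ → ℝ} {h k : L2R}

theorem integral_conj_sub_mul_tau_eq_zero
    (H : ∀ y ∈ compactDomain q, inner ℂ h (tauL2 q y) = inner ℂ k (toL2 q y)) {u : ℝ → ℂ}
    (hu : IsACTwo u) (hτ : tau q u =ᵐ[volume] k) {y : maxDomain q} (hy : y ∈ compactDomain q) :
    ∫ t, conj (h t - u t) * tau q y t = 0 := by
  have hleft : inner ℂ h (tauL2 q y) = ∫ t, conj (h t) * tau q y t := by
    conv_lhs => rw [← Lp.toLp_coeFn h (Lp.memLp h)]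
    exact inner_toLp (Lp.memLp h) y.2.memLp_tau
  have hright : inner ℂ k (toL2 q y) = ∫ t, conj (u t) * tau q y t := by
    have hτu : MemLp (tau q u) 2 volume := (Lp.memLp k).ae_eq hτ.symm
    rw [← integral_conj_tau_mul hu hτu y.2 hy, ← Lp.toLp_coeFn k (Lp.memLp k),
      MemLp.toLp_congr (Lp.memLp k) hτu hτ.symm]
    exact inner_toLp hτu y.2.memLp
  simp only [map_sub, sub_mul]
  rw [integral_sub (integrable_conj_mul (Lp.memLp h) y.2.memLp_tau)
    (integrable_conj_mul_tau hu.continuous y.2 hy), ← hleft, ← hright, H y hy, sub_self]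

namespace IsFundamentalPair

variable {w₁ w₂ : ℝ → ℂ}

/- On an interval `Ioc a b`, the class of `h - u` is orthogonal to the orthogonal complement of the
span of `w₁` and `w₂`, because each element of that complement is the image under `τ_q` of a
function of compact support. -/
theorem exists_ae_eq_add_of_weak (hw : IsFundamentalPair q w₁ w₂)
    (H : ∀ y ∈ compactDomain q, inner ℂ h (tauL2 q y) = inner ℂ k (toL2 q y)) {u : ℝ → ℂ}
    (hu : IsACTwo u) (hτ : tau q u =ᵐ[volume] k) (a b : ℝ) :
    ∃ c₁ c₂ : ℂ, ∀ᵐ x ∂volume.restrict (Set.Ioc a b), h x = u x + c₁ * w₁ x + c₂ * w₂ x := by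
  let v₁ := (memLp_restrict_Ioc hw.continuous₁ 2 a b).toLp w₁
  let v₂ := (memLp_restrict_Ioc hw.continuous₂ 2 a b).toLp w₂
  have hr : MemLp (fun t => h t - u t) 2 (volume.restrict (Set.Ioc a b)) :=
    (Lp.memLp h).restrict _ |>.sub (memLp_restrict_Ioc hu.continuous 2 a b)
  have := FiniteDimensional.span_of_finite ℂ (Set.toFinite {v₁, v₂})
  have hspan : hr.toLp _ ∈ Submodule.span ℂ {v₁, v₂} := by
    rw [← Submodule.orthogonal_orthogonal (Submodule.span ℂ {v₁, v₂}), Submodule.mem_orthogonal']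
    intro p hp
    rw [Submodule.mem_orthogonal] at hp
    obtain ⟨y, hy, hyp⟩ := hw.exists_compactDomain_tau_ae_eq
      (memLp_indicator_coeFn measurableSet_Ioc p) Set.support_indicator_subset
      ((hw.integral_mul₁_indicator p).trans (hp _ (Submodule.mem_span_of_mem (by simp [v₁, v₂]))))
      ((hw.integral_mul₂_indicator p).trans (hp _ (Submodule.mem_span_of_mem (by simp [v₁, v₂]))))
    rw [← integral_conj_mul_indicator measurableSet_Ioc hr,
      ← integral_conj_sub_mul_tau_eq_zero H hu hτ hy]
    exact integral_congr_ae (hyp.mono fun t ht => by simp only [ht])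
  obtain ⟨c₁, c₂, hc⟩ := Submodule.mem_span_pair.1 hspan
  simp only [v₁, v₂] at hc
  rw [← MemLp.toLp_const_smul, ← MemLp.toLp_const_smul, ← MemLp.toLp_add,
    MemLp.toLp_eq_toLp_iff] at hc
  refine ⟨c₁, c₂, hc.mono fun x hx => ?_⟩
  simp only [Pi.add_apply, Pi.smul_apply, smul_eq_mul] at hx
  linear_combination -hx

theorem exists_maxDomain_of_weak (hw : IsFundamentalPair q w₁ w₂)
    (H : ∀ y ∈ compactDomain q, inner ℂ h (tauL2 q y) = inner ℂ k (toL2 q y)) :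
    ∃ u : maxDomain q, toL2 q u = h ∧ tauL2 q u = k := by
  have hk : LocallyIntegrable k volume := (Lp.memLp k).locallyIntegrable one_le_two
  choose c₁ c₂ hc using fun n : ℕ => hw.exists_ae_eq_add_of_weak H
    (hw.isACTwo_variation hk 0 0 0) (hw.tau_variation_ae_eq hk 0 0 0) (-(n + 1)) (n + 1)
  have hconst : ∀ n, c₁ n = c₁ 0 ∧ c₂ n = c₂ 0 := fun n => by
    rw [← sub_eq_zero (a := c₁ n), ← sub_eq_zero (a := c₂ n)]
    refine hw.eq_zero_of_ae_eq_zero (show (-1 : ℝ) < 1 by norm_num) ?_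
    have hsub (m : ℕ) : Set.Ioc (-1 : ℝ) 1 ⊆ Set.Ioc (-(m + 1 : ℝ)) (m + 1) :=
      Set.Ioc_subset_Ioc (by simp) (by simp)
    filter_upwards [ae_restrict_of_ae_restrict_of_subset (hsub n) (hc n),
      ae_restrict_of_ae_restrict_of_subset (hsub 0) (hc 0)] with x hn h0
    linear_combination h0 - hn
  have hae : variation w₁ w₂ k 0 (c₁ 0) (c₂ 0) =ᵐ[volume] h := by
    filter_upwards [ae_all_iff.2 fun n => (ae_restrict_iff' measurableSet_Ioc).1 (hc n)] with x hx
    obtain ⟨n, hn⟩ := exists_nat_ge |x|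
    have hxn := abs_le.1 hn
    rw [hx n ⟨by linarith, by linarith⟩, (hconst n).1, (hconst n).2]
    simp only [variation]
    ring
  have htau := hw.tau_variation_ae_eq hk 0 (c₁ 0) (c₂ 0)
  have hmax : InMaxDomain q (variation w₁ w₂ k 0 (c₁ 0) (c₂ 0)) :=
    ⟨hw.isACTwo_variation hk _ _ _, (Lp.memLp h).ae_eq hae.symm, (Lp.memLp k).ae_eq htau.symm⟩
  exact ⟨⟨_, hmax⟩, Lp.ext (hmax.memLp.coeFn_toLp.trans hae),
    Lp.ext (hmax.memLp_tau.coeFn_toLp.trans htau)⟩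

end IsFundamentalPair

end Weak

/-! ### Bi-extensions and their adjoints -/

theorem preminOp_domain_mem {q : ℝ → ℝ} {y : maxDomain q} (hy : y ∈ compactDomain q) :
    toL2 q y ∈ (preminOp q).domain :=
  ⟨Submodule.mem_map_of_mem hy, LinearMap.mem_range_self _ y⟩

theorem preminOp_apply {q : ℝ → ℝ} {y : maxDomain q} (hy : y ∈ compactDomain q) :
    preminOp q ⟨toL2 q y, preminOp_domain_mem hy⟩ = tauL2 q y :=
  (LinearPMap.domRestrict_apply (y := ⟨toL2 q y, LinearMap.mem_range_self _ y⟩) rfl).trans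
    (maxOp_apply q y)

theorem apply_toL2_of_le_maxOp {q : ℝ → ℝ} {T : L2R →ₗ.[ℂ] L2R} (hT : T ≤ maxOp q)
    {f : maxDomain q} (hf : toL2 q f ∈ T.domain) : T ⟨toL2 q f, hf⟩ = tauL2 q f :=
  (hT.2 rfl).trans (maxOp_apply q f)

namespace IsFundamentalPair

variable {q : ℝ → ℝ} {w₁ w₂ : ℝ → ℂ}

theorem dense_preminOp_domain (hw : IsFundamentalPair q w₁ w₂) :
    Dense ((preminOp q).domain : Set L2R) := by
  rw [Submodule.dense_iff_topologicalClosure_eq_top, Submodule.topologicalClosure_eq_top_iff,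
    Submodule.eq_bot_iff]
  intro k hk
  rw [Submodule.mem_orthogonal'] at hk
  obtain ⟨u, h_zero, rfl⟩ := hw.exists_maxDomain_of_weak (h := 0) (k := k) fun y hy => by
    rw [inner_zero_left, hk _ (preminOp_domain_mem hy)]
  rw [toL2_injective q (h_zero.trans (map_zero _).symm), map_zero]

theorem adjoint_le_maxOp (hw : IsFundamentalPair q w₁ w₂) {S : L2R →ₗ.[ℂ] L2R}
    (hS : preminOp q ≤ S) : S† ≤ maxOp q := by
  have hdense : Dense (S.domain : Set L2R) := hw.dense_preminOp_domain.mono hS.1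
  have hrep (x : S†.domain) : ∃ u : maxDomain q, toL2 q u = x ∧ tauL2 q u = S† x := by
    refine hw.exists_maxDomain_of_weak fun y hy => ?_
    have hformal := LinearPMap.adjoint_isFormalAdjoint hdense x ⟨_, hS.1 (preminOp_domain_mem hy)⟩
    rw [← hS.2 (x := ⟨_, preminOp_domain_mem hy⟩) rfl, preminOp_apply hy] at hformal
    exact hformal.symm
  refine ⟨fun x hx => ?_, ?_⟩
  · obtain ⟨u, rfl, -⟩ := hrep ⟨x, hx⟩
    exact LinearMap.mem_range_self _ u
  · rintro x ⟨_, hy⟩ rfl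
    obtain ⟨u, hux, hu⟩ := hrep x
    rw [← hu, ← maxOp_apply]
    exact congrArg _ (Subtype.ext hux)

theorem le_maxOp_of_isBiExtension (hw : IsFundamentalPair q w₁ w₂) {T : L2R →ₗ.[ℂ] L2R}
    (hT : IsBiExtension (minOp q) T) : T ≤ maxOp q :=
  hT.le_adjoint.trans (hw.adjoint_le_maxOp (LinearPMap.le_closure _))

theorem adjoint_domain_eq (hw : IsFundamentalPair q w₁ w₂) {T : L2R →ₗ.[ℂ] L2R}
    (hT : IsBiExtension (minOp q) T) {s : Set (maxDomain q)}
    (hs : (T.domain : Set L2R) = toL2 q '' s) :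
    ((T†).domain : Set L2R) = toL2 q '' {g | ∀ f ∈ s, bracketBot g f = bracketTop g f} := by
  have hle : preminOp q ≤ T := (LinearPMap.le_closure _).trans hT.le
  have hmax : T ≤ maxOp q := hw.le_maxOp_of_isBiExtension hT
  have hmem {f : maxDomain q} (hf : f ∈ s) : toL2 q f ∈ T.domain := by
    rw [← SetLike.mem_coe, hs]
    exact Set.mem_image_of_mem _ hf
  ext x
  constructor
  · intro hx
    obtain ⟨g, rfl⟩ := (hw.adjoint_le_maxOp hle).1 hx
    refine ⟨g, fun f hf => ?_, rfl⟩
    have hformal := LinearPMap.adjoint_isFormalAdjoint (hw.dense_preminOp_domain.mono hle.1)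
      ⟨_, hx⟩ ⟨_, hmem hf⟩
    rw [apply_toL2_of_le_maxOp (hw.adjoint_le_maxOp hle), apply_toL2_of_le_maxOp hmax,
      ← sub_eq_zero, inner_tauL2_sub_inner_toL2, sub_eq_zero] at hformal
    exact hformal.symm
  · rintro ⟨g, hg, rfl⟩
    refine LinearPMap.mem_adjoint_domain_of_exists _ ⟨tauL2 q g, ?_⟩
    rintro ⟨y, hy⟩
    obtain ⟨f, hf, rfl⟩ := hs.subset hy
    rw [apply_toL2_of_le_maxOp hmax, ← sub_eq_zero, inner_tauL2_sub_inner_toL2, hg f hf, sub_self]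

end IsFundamentalPair

/-! ### Boundary values -/

namespace IsBoundaryPair

variable {q : ℝ → ℝ} {w₁ w₂ : ℝ → ℂ}

theorem bracketTop_eq (hw : IsBoundaryPair q w₁ w₂) (f g : maxDomain q) :
    bracketTop f g = conj (bracketTop w₁ f) * bracketTop w₂ g -
      conj (bracketTop w₂ f) * bracketTop w₁ g :=
  (hw.isFundamentalPair.tendsto_bracket (hw.mem₁.tendsto_bracketTop f.2)
    (hw.mem₂.tendsto_bracketTop f.2) (hw.mem₁.tendsto_bracketTop g.2)
    (hw.mem₂.tendsto_bracketTop g.2)).limUnder_eq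

theorem bracketBot_eq (hw : IsBoundaryPair q w₁ w₂) (f g : maxDomain q) :
    bracketBot f g = conj (bracketBot w₁ f) * bracketBot w₂ g -
      conj (bracketBot w₂ f) * bracketBot w₁ g :=
  (hw.isFundamentalPair.tendsto_bracket (hw.mem₁.tendsto_bracketBot f.2)
    (hw.mem₂.tendsto_bracketBot f.2) (hw.mem₁.tendsto_bracketBot g.2)
    (hw.mem₂.tendsto_bracketBot g.2)).limUnder_eq

theorem exists_boundary_values (hw : IsBoundaryPair q w₁ w₂) (a₁ a₂ b₁ b₂ : ℂ) :
    ∃ y : maxDomain q, bracketBot w₁ y = a₁ ∧ bracketBot w₂ y = a₂ ∧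
      bracketTop w₁ y = b₁ ∧ bracketTop w₂ y = b₂ := by
  have hpair := hw.isFundamentalPair
  obtain ⟨k, hk, hsupp, hk₁, hk₂⟩ := hpair.exists_integral_mul_eq one_pos (a₁ - b₁) (a₂ - b₂)
  have hloc := hk.locallyIntegrable one_le_two
  have hsupp₁ : Function.support (fun t => w₁ t * k t) ⊆ Set.Ioc 0 1 :=
    (Function.support_mul_subset_right _ _).trans hsupp
  have hsupp₂ : Function.support (fun t => w₂ t * k t) ⊆ Set.Ioc 0 1 :=
    (Function.support_mul_subset_right _ _).trans hsupp
  refine ⟨⟨variation w₁ w₂ k 0 (-a₂) a₁,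
    hpair.inMaxDomain_variation hw.mem₁.memLp hw.mem₂.memLp hk _ _ _⟩,
    (tendsto_const_nhds.congr' ?_).limUnder_eq, (tendsto_const_nhds.congr' ?_).limUnder_eq,
    (tendsto_const_nhds.congr' ?_).limUnder_eq, (tendsto_const_nhds.congr' ?_).limUnder_eq⟩
  · filter_upwards [eventually_le_atBot (0 : ℝ)] with x hx
    rw [hpair.bracket₁_variation hloc, integral_eq_zero_of_le_of_support_subset hsupp₁ hx, sub_zero]
  · filter_upwards [eventually_le_atBot (0 : ℝ)] with x hx
    rw [hpair.bracket₂_variation hloc, integral_eq_zero_of_le_of_support_subset hsupp₂ hx,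
      add_zero, neg_neg]
  · filter_upwards [eventually_ge_atTop (1 : ℝ)] with x hx
    rw [hpair.bracket₁_variation hloc, integral_eq_integral_of_ge_of_support_subset hsupp₁ hx, hk₁,
      sub_sub_cancel]
  · filter_upwards [eventually_ge_atTop (1 : ℝ)] with x hx
    rw [hpair.bracket₂_variation hloc, integral_eq_integral_of_ge_of_support_subset hsupp₂ hx, hk₂]
    ring

end IsBoundaryPair

/-! ### Reflection -/

theorem deriv_reflect (y : ℝ → ℂ) : deriv (fun x => y (-x)) = fun x => -deriv y (-x) :=
  funext fun x => deriv_comp_neg y x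

theorem IsACTwo.reflect {y : ℝ → ℂ} (hy : IsACTwo y) : IsACTwo fun x => y (-x) where
  diff := hy.diff.comp differentiable_neg
  ac := hy.ac.comp_neg
  ac_deriv := by
    rw [deriv_reflect]
    exact hy.ac_deriv.comp_neg.neg

theorem tau_reflect {q : ℝ → ℝ} (hq : ∀ x, q x = q (-x)) (y : ℝ → ℂ) (x : ℝ) :
    tau q (fun x => y (-x)) x = tau q y (-x) := by
  rw [tau, deriv_reflect, deriv.fun_neg, deriv_comp_neg, neg_neg, hq x, tau]

theorem InMaxDomain.reflect {q : ℝ → ℝ} (hq : ∀ x, q x = q (-x)) {y : ℝ → ℂ}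
    (hy : InMaxDomain q y) : InMaxDomain q fun x => y (-x) where
  ac := hy.ac.reflect
  memLp := hy.memLp.comp_measurePreserving (Measure.measurePreserving_neg volume)
  memLp_tau := by
    rw [funext (tau_reflect hq y)]
    exact hy.memLp_tau.comp_measurePreserving (Measure.measurePreserving_neg volume)

/-- The parity operator `(P y)(x) = y(-x)` on the functions of the maximal domain, for an even
potential. -/
def reflect {q : ℝ → ℝ} (hq : ∀ x, q x = q (-x)) (y : maxDomain q) : maxDomain q :=
  ⟨fun x => (y : ℝ → ℂ) (-x), y.2.reflect hq⟩

theorem reflect_involutive {q : ℝ → ℝ} (hq : ∀ x, q x = q (-x)) :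
    Function.Involutive (reflect hq) :=
  fun y => Subtype.ext (funext fun x => congrArg (y : ℝ → ℂ) (neg_neg x))

theorem parity_toL2 {q : ℝ → ℝ} (hq : ∀ x, q x = q (-x)) (y : maxDomain q) :
    parity (toL2 q y) = toL2 q (reflect hq y) := rfl

theorem parity_involutive : Function.Involutive parity := fun f => by
  rw [← Lp.toLp_coeFn f (Lp.memLp f)]
  exact MemLp.toLp_congr (((Lp.memLp f).comp_measurePreserving
    (Measure.measurePreserving_neg volume)).comp_measurePreserving
    (Measure.measurePreserving_neg volume)) (Lp.memLp f)
    (Eventually.of_forall fun x => congrArg f (neg_neg x))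

theorem kreinAdjoint_domain_eq (T : L2R →ₗ.[ℂ] L2R) :
    ((kreinAdjoint T).domain : Set L2R) = parity '' ((T†).domain : Set L2R) := by
  rw [Set.image_eq_preimage_of_inverse parity_involutive parity_involutive]
  rfl

theorem parity_image_toL2_image {q : ℝ → ℝ} (hq : ∀ x, q x = q (-x)) (s : Set (maxDomain q)) :
    parity '' (toL2 q '' s) = toL2 q '' (reflect hq ⁻¹' s) := by
  rw [← Set.image_eq_preimage_of_inverse (reflect_involutive hq) (reflect_involutive hq),
    Set.image_image, Set.image_image]
  simp only [parity_toL2 hq]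

theorem bracket_reflect_of_odd {f : ℝ → ℂ} (hf : Function.Odd f) (g : ℝ → ℂ) (x : ℝ) :
    bracket f (fun t => g (-t)) x = bracket f g (-x) := by
  have hderiv : deriv f (-x) = deriv f x := by
    rw [← neg_inj, ← deriv_comp_neg, show (fun t => f (-t)) = fun t => -f t from funext hf,
      deriv.fun_neg]
  rw [bracket, bracket, deriv_reflect, hderiv, hf, map_neg]
  ring

theorem bracket_reflect_of_even {f : ℝ → ℂ} (hf : Function.Even f) (g : ℝ → ℂ) (x : ℝ) :
    bracket f (fun t => g (-t)) x = -bracket f g (-x) := by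
  have hderiv : deriv f (-x) = -deriv f x := by
    rw [← neg_eq_iff_eq_neg, ← deriv_comp_neg, funext hf]
  rw [bracket, bracket, deriv_reflect, hderiv, hf, map_neg]
  ring

section BoundaryReflect

variable {q : ℝ → ℝ} {f : ℝ → ℂ} (hf : InMaxDomain q f) (hq : ∀ x, q x = q (-x))
  (g : maxDomain q)

include hf

theorem bracketTop_reflect_of_odd (hodd : Function.Odd f) :
    bracketTop f (reflect hq g) = bracketBot f g :=
  (((hf.tendsto_bracketBot g.2).comp tendsto_neg_atTop_atBot).congr fun x =>
    (bracket_reflect_of_odd hodd g x).symm).limUnder_eq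

theorem bracketBot_reflect_of_odd (hodd : Function.Odd f) :
    bracketBot f (reflect hq g) = bracketTop f g :=
  (((hf.tendsto_bracketTop g.2).comp tendsto_neg_atBot_atTop).congr fun x =>
    (bracket_reflect_of_odd hodd g x).symm).limUnder_eq

theorem bracketTop_reflect_of_even (heven : Function.Even f) :
    bracketTop f (reflect hq g) = -bracketBot f g :=
  (((hf.tendsto_bracketBot g.2).comp tendsto_neg_atTop_atBot).neg.congr fun x =>
    (bracket_reflect_of_even heven g x).symm).limUnder_eq

theorem bracketBot_reflect_of_even (heven : Function.Even f) :
    bracketBot f (reflect hq g) = -bracketTop f g :=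
  (((hf.tendsto_bracketTop g.2).comp tendsto_neg_atBot_atTop).neg.congr fun x =>
    (bracket_reflect_of_even heven g x).symm).limUnder_eq

end BoundaryReflect

/-! ### Annihilators of boundary conditions -/

theorem forall_linear_eq_zero_imp_iff {K : Type*} [Field K] {a b r s : K} (h : a ≠ 0 ∨ b ≠ 0) :
    (∀ u v, a * u + b * v = 0 → r * u + s * v = 0) ↔ r * b = s * a := by
  refine ⟨fun H => ?_, fun H u v huv => ?_⟩
  · linear_combination H b (-a) (by ring)
  · rcases h with ha | hb
    · exact mul_left_cancel₀ ha (by linear_combination r * huv - v * H)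
    · exact mul_left_cancel₀ hb (by linear_combination s * huv + u * H)

theorem forall_boundary_form_eq_iff {X : Type*} {u₁ u₂ v₁ v₂ : X → ℂ}
    (hsurj : ∀ a₁ a₂ b₁ b₂ : ℂ, ∃ x, u₁ x = a₁ ∧ u₂ x = a₂ ∧ v₁ x = b₁ ∧ v₂ x = b₂)
    {α β γ δ a b c d : ℂ} (hab : a ≠ 0 ∨ b ≠ 0)
    (hcd : ![c, d] = -(!![conj δ, -conj γ; -conj β, conj α] *ᵥ ![conj a, conj b]))
    (s₁ s₂ t₁ t₂ : ℂ) :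
    (∀ x, a * u₁ x + b * u₂ x = 0 ∧ !![α, β; γ, δ] *ᵥ ![u₁ x, u₂ x] = ![v₁ x, v₂ x] →
      conj s₁ * u₂ x - conj s₂ * u₁ x = conj t₁ * v₂ x - conj t₂ * v₁ x) ↔
    conj a * s₁ + conj b * s₂ + c * t₁ + d * t₂ = 0 := by
  have hlinear : (∀ x, a * u₁ x + b * u₂ x = 0 ∧
      !![α, β; γ, δ] *ᵥ ![u₁ x, u₂ x] = ![v₁ x, v₂ x] →
      conj s₁ * u₂ x - conj s₂ * u₁ x = conj t₁ * v₂ x - conj t₂ * v₁ x) ↔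
      ∀ u v, a * u + b * v = 0 → (conj t₂ * α - conj t₁ * γ - conj s₂) * u +
        (conj t₂ * β - conj t₁ * δ + conj s₁) * v = 0 := by
    simp only [Matrix.mulVec_fin_two, Matrix.of_apply, Matrix.cons_val', Matrix.cons_val_zero,
      Matrix.cons_val_one, Matrix.cons_val_fin_one, Matrix.vecCons_inj, and_true]
    refine ⟨fun H u v huv => ?_, fun H x ⟨huv, hv₁, hv₂⟩ => ?_⟩
    · obtain ⟨x, rfl, rfl, hv₁, hv₂⟩ := hsurj u v (α * u + β * v) (γ * u + δ * v)
      have hform := H x ⟨huv, hv₁.symm, hv₂.symm⟩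
      rw [hv₁, hv₂] at hform
      linear_combination hform
    · rw [← hv₁, ← hv₂]
      linear_combination H _ _ huv
  simp only [Matrix.mulVec_fin_two, Matrix.of_apply, Matrix.cons_val', Matrix.cons_val_zero,
    Matrix.cons_val_one, Matrix.cons_val_fin_one, Matrix.neg_cons, Matrix.neg_empty,
    Matrix.vecCons_inj, and_true] at hcd
  rw [hlinear, forall_linear_eq_zero_imp_iff hab, ← star_inj, hcd.1, hcd.2]
  simp only [Complex.star_def, map_add, map_sub, map_mul, Complex.conj_conj]
  constructor <;> intro h <;> linear_combination -h

theorem ne_zero_or_ne_zero_of_norm_add_norm_ne_zero {E F : Type*} [SeminormedAddCommGroup E]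
    [SeminormedAddCommGroup F] {a : E} {b : F} (h : ‖a‖ + ‖b‖ ≠ 0) : a ≠ 0 ∨ b ≠ 0 := by
  contrapose! h
  rw [h.1, h.2, norm_zero, norm_zero, add_zero]

namespace IsBoundaryPair

variable {q : ℝ → ℝ} {w₁ w₂ : ℝ → ℂ}

theorem reflect_preimage_boundary_condition (hw : IsBoundaryPair q w₁ w₂)
    (hq : ∀ x, q x = q (-x)) (a b c d : ℂ) :
    reflect hq ⁻¹' {g | a * bracketBot w₁ g + b * bracketBot w₂ g + c * bracketTop w₁ g +
        d * bracketTop w₂ g = 0} =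
      {h : maxDomain q | a * bracketTop w₁ h - b * bracketTop w₂ h + c * bracketBot w₁ h -
        d * bracketBot w₂ h = 0} := by
  ext h
  simp only [Set.mem_preimage, Set.mem_ofPred_eq, bracketTop_reflect_of_odd hw.mem₁ hq h hw.odd₁,
    bracketBot_reflect_of_odd hw.mem₁ hq h hw.odd₁,
    bracketTop_reflect_of_even hw.mem₂ hq h hw.even₂,
    bracketBot_reflect_of_even hw.mem₂ hq h hw.even₂, mul_neg, ← sub_eq_add_neg]

theorem adjoint_and_kreinAdjoint_domain_eq (hw : IsBoundaryPair q w₁ w₂)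
    (hq : ∀ x, q x = q (-x)) {T : L2R →ₗ.[ℂ] L2R} (hT : IsBiExtension (minOp q) T)
    {s : Set (maxDomain q)} (hs : (T.domain : Set L2R) = toL2 q '' s) {a b c d : ℂ}
    (h : ∀ g : maxDomain q, (∀ f ∈ s, bracketBot g f = bracketTop g f) ↔
      a * bracketBot w₁ g + b * bracketBot w₂ g + c * bracketTop w₁ g + d * bracketTop w₂ g = 0) :
    ((T†).domain : Set L2R) = toL2 q '' {g | a * bracketBot w₁ g + b * bracketBot w₂ g +
        c * bracketTop w₁ g + d * bracketTop w₂ g = 0} ∧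
      ((kreinAdjoint T).domain : Set L2R) = parity '' ((T†).domain : Set L2R) ∧
      ((kreinAdjoint T).domain : Set L2R) = toL2 q '' {h | a * bracketTop w₁ h -
        b * bracketTop w₂ h + c * bracketBot w₁ h - d * bracketBot w₂ h = 0} := by
  have hadj := hw.isFundamentalPair.adjoint_domain_eq hT hs
  simp only [h] at hadj
  refine ⟨hadj, kreinAdjoint_domain_eq T, ?_⟩
  rw [kreinAdjoint_domain_eq, hadj, parity_image_toL2_image hq,
    hw.reflect_preimage_boundary_condition hq]

theorem forall_bracketBot_eq_bracketTop_iff_of_bot (hw : IsBoundaryPair q w₁ w₂)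
    {α β γ δ a b c d : ℂ} (hab : a ≠ 0 ∨ b ≠ 0)
    (hcd : ![c, d] = -(!![conj δ, -conj γ; -conj β, conj α] *ᵥ ![conj a, conj b]))
    (g : maxDomain q) :
    (∀ f : maxDomain q, a * bracketBot w₁ f + b * bracketBot w₂ f = 0 ∧
        !![α, β; γ, δ] *ᵥ ![bracketBot w₁ f, bracketBot w₂ f] =
          ![bracketTop w₁ f, bracketTop w₂ f] → bracketBot g f = bracketTop g f) ↔
      conj a * bracketBot w₁ g + conj b * bracketBot w₂ g + c * bracketTop w₁ g +
        d * bracketTop w₂ g = 0 := by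
  simp only [hw.bracketBot_eq, hw.bracketTop_eq]
  exact forall_boundary_form_eq_iff hw.exists_boundary_values hab hcd _ _ _ _

theorem forall_bracketBot_eq_bracketTop_iff_of_top (hw : IsBoundaryPair q w₁ w₂)
    {α β γ δ a b c d : ℂ} (hcd : c ≠ 0 ∨ d ≠ 0)
    (hab : ![a, b] = -(!![conj δ, -conj γ; -conj β, conj α] *ᵥ ![conj c, conj d]))
    (g : maxDomain q) :
    (∀ f : maxDomain q, c * bracketTop w₁ f + d * bracketTop w₂ f = 0 ∧
        !![α, β; γ, δ] *ᵥ ![bracketTop w₁ f, bracketTop w₂ f] =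
          ![bracketBot w₁ f, bracketBot w₂ f] → bracketBot g f = bracketTop g f) ↔
      a * bracketBot w₁ g + b * bracketBot w₂ g + conj c * bracketTop w₁ g +
        conj d * bracketTop w₂ g = 0 := by
  have hsurj (b₁ b₂ a₁ a₂ : ℂ) : ∃ y : maxDomain q, bracketTop w₁ y = b₁ ∧
      bracketTop w₂ y = b₂ ∧ bracketBot w₁ y = a₁ ∧ bracketBot w₂ y = a₂ := by
    obtain ⟨y, ha₁, ha₂, hb₁, hb₂⟩ := hw.exists_boundary_values a₁ a₂ b₁ b₂
    exact ⟨y, hb₁, hb₂, ha₁, ha₂⟩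
  simp only [hw.bracketBot_eq, hw.bracketTop_eq, eq_comm (b := conj (bracketTop w₁ g) * _ - _)]
  rw [forall_boundary_form_eq_iff hsurj hcd hab, add_assoc, add_comm, ← add_assoc]

end IsBoundaryPair

end PTSymm

theorem mainTheorem11
    (q : ℝ → ℝ) (hq : LocallyIntegrable q volume) (hq_even : ∀ x, q x = q (-x))
    (htop : LimitCircleAtTop q) (hbot : LimitCircleAtBot q)
    (w₁ w₂ : ℝ → ℂ) (hw : IsBoundaryPair q w₁ w₂)
    (T : L2R →ₗ.[ℂ] L2R) (hT : IsBiExtension (minOp q) T)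
    (α₁ α₂ β₁ β₂ : maxDomain q → ℂ)
    (hα₁ : ∀ f, α₁ f = bracketBot w₁ f) (hα₂ : ∀ f, α₂ f = bracketBot w₂ f)
    (hβ₁ : ∀ f, β₁ f = bracketTop w₁ f) (hβ₂ : ∀ f, β₂ f = bracketTop w₂ f)
    (α β γ δ : ℂ) :
    (∀ a₁ b₁ : ℂ, ‖a₁‖ + ‖b₁‖ ≠ 0 →
      (T.domain : Set L2R) = toL2 q '' {f | a₁ * α₁ f + b₁ * α₂ f = 0 ∧
        !![α, β; γ, δ] *ᵥ ![α₁ f, α₂ f] = ![β₁ f, β₂ f]} →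
      ∀ a b c d : ℂ, a = conj a₁ → b = conj b₁ →
        ![c, d] = -(!![conj δ, -conj γ; -conj β, conj α] *ᵥ ![conj a₁, conj b₁]) →
        ((T†).domain : Set L2R) =
            toL2 q '' {g | a * α₁ g + b * α₂ g + c * β₁ g + d * β₂ g = 0} ∧
        ((kreinAdjoint T).domain : Set L2R) = parity '' ((T†).domain : Set L2R) ∧
        ((kreinAdjoint T).domain : Set L2R) =
            toL2 q '' {h | a * β₁ h - b * β₂ h + c * α₁ h - d * α₂ h = 0}) ∧
    (∀ c₁ d₁ : ℂ, ‖c₁‖ + ‖d₁‖ ≠ 0 →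
      (T.domain : Set L2R) = toL2 q '' {f | c₁ * β₁ f + d₁ * β₂ f = 0 ∧
        !![α, β; γ, δ] *ᵥ ![β₁ f, β₂ f] = ![α₁ f, α₂ f]} →
      ∀ a b c d : ℂ, c = conj c₁ → d = conj d₁ →
        ![a, b] = -(!![conj δ, -conj γ; -conj β, conj α] *ᵥ ![conj c₁, conj d₁]) →
        ((T†).domain : Set L2R) =
            toL2 q '' {g | a * α₁ g + b * α₂ g + c * β₁ g + d * β₂ g = 0} ∧
        ((kreinAdjoint T).domain : Set L2R) = parity '' ((T†).domain : Set L2R) ∧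
        ((kreinAdjoint T).domain : Set L2R) =
            toL2 q '' {h | a * β₁ h - b * β₂ h + c * α₁ h - d * α₂ h = 0}) := by
  obtain rfl : α₁ = fun f : maxDomain q => bracketBot w₁ f := funext hα₁
  obtain rfl : α₂ = fun f : maxDomain q => bracketBot w₂ f := funext hα₂
  obtain rfl : β₁ = fun f : maxDomain q => bracketTop w₁ f := funext hβ₁
  obtain rfl : β₂ = fun f : maxDomain q => bracketTop w₂ f := funext hβ₂
  constructor
  · rintro a₁ b₁ hab hdom _ _ c d rfl rfl hcd
    exact hw.adjoint_and_kreinAdjoint_domain_eq hq_even hT hdom <|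
      hw.forall_bracketBot_eq_bracketTop_iff_of_bot
        (ne_zero_or_ne_zero_of_norm_add_norm_ne_zero hab) hcd
  · rintro c₁ d₁ hcd hdom a b _ _ rfl rfl hab
    exact hw.adjoint_and_kreinAdjoint_domain_eq hq_even hT hdom <|
      hw.forall_bracketBot_eq_bracketTop_iff_of_top
        (ne_zero_or_ne_zero_of_norm_add_norm_ne_zero hcd) hab
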